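/- Let $\mathcal L$ be the algebraic language with a binary symbol $\oplus$, a unary symbol ${}^*$, a constant $0$ and a unary symbol $\rho_r$ for each $r\in[0,1]$; in an $\mathcal L$-algebra write $r\cdot x$ for $\rho_r(x)$ and $x\odot y=(x^*\oplus y^*)^*$. The standard algebra $[0,1]$ has $x\oplus y=\min(1,x+y)$, $x^*=1-x$, constant $0$, and $r\cdot x=rx$ (product of real numbers). A Riesz MV-algebra is an $\mathcal L$-algebra $R$ such that $(R,\oplus,0)$ is an abelian monoid and, for all $x,y\in R$ and $r,q\in[0,1]$, $$x^{**}=x,\qquad 0^*\oplus x=0^*,\qquad (x^*\oplus y)^*\oplus y=(y^*\oplus x)^*\oplus x,$$ $$r\cdot(x\odot y^*)=(r\cdot x)\odot(r\cdot y)^*,\qquad (r\odot q^*)\cdot x=(r\cdot x)\odot(q\cdot x)^*,\qquad r\cdot(q\cdot x)=(rq)\cdot x,\qquad 1\cdot x=x,$$ where $r\odot q^*=\max(0,r-q)$ is computed in the standard algebra $[0,1]$ and $rq$ is the real product. **Theorem.** For all $\mathcal L$-terms $t,s$ (in variables $v_0,v_1,v_2,\dots$), the equation $t=s$ holds in every Riesz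 MV-algebra if and only if it holds in the standard Riesz MV-algebra $[0,1]$. Moreover, the class of Riesz MV-algebras is the variety generated by $[0,1]$, i.e. the smallest class of $\mathcal L$-algebras that contains all isomorphic copies of $[0,1]$ and is closed under homomorphic images, subalgebras and direct products. -/

import Mathlib

open scoped FirstOrder

universe u

namespace RieszMV

/-! ### The language of Riesz MV-algebras -/

/-- Function symbols: a constant `0`, a unary `*`, a binary `⊕`, and a unary symbol `ρ_r`
for every real `r ∈ [0,1]`. -/
inductive Func : ℕ → Type
  | zero : Func 0
  | neg : Func 1
  | scal (r : unitInterval) : Func 1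
  | oplus : Func 2

/-- The language of Riesz MV-algebras `{⊕, *, 0, {ρ_r}_{r ∈ [0,1]}}`; it has no relation symbols. -/
def lang : FirstOrder.Language.{0, 0} := ⟨Func, fun _ => Empty⟩

/-! ### The operations of an algebra of this language -/

section Operations

variable {A : Type*} [lang.Structure A]

/-- The constant `0`. -/
def zero (A : Type*) [lang.Structure A] : A :=
  FirstOrder.Language.Structure.funMap (L := lang) (M := A) Func.zero ![]

/-- The complement `x*`. -/
def neg (x : A) : A := FirstOrder.Language.Structure.funMap (L := lang) Func.neg ![x]

/-- The scalar multiplication `r · x`, the interpretation of `ρ_r`. -/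
def smul (r : unitInterval) (x : A) : A := FirstOrder.Language.Structure.funMap (L := lang) (Func.scal r) ![x]

/-- The truncated sum `x ⊕ y`. -/
def oplus (x y : A) : A := FirstOrder.Language.Structure.funMap (L := lang) Func.oplus ![x, y]

/-- The derived operation `x ⊙ y = (x* ⊕ y*)*`. -/
def odot (x y : A) : A := neg (oplus (neg x) (neg y))

end Operations

/-! ### The standard algebra `[0,1]` -/

/-- The truncated sum `min (1, x + y)` on `[0,1]`. -/
def stdOplus (x y : unitInterval) : unitInterval :=
  ⟨min 1 (x + y : ℝ), le_min zero_le_one (add_nonneg x.2.1 y.2.1), min_le_left _ _⟩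

/-- The standard algebra on `[0,1]`: `x ⊕ y = min (1, x + y)`, `x* = 1 - x`, the constant `0`, and
`r · x` the product of real numbers. -/
instance stdStructure : lang.Structure unitInterval where
  funMap {_} f :=
    match f with
    | Func.zero => fun _ => 0
    | Func.neg => fun v => unitInterval.symm (v 0)
    | Func.scal r => fun v => r * v 0
    | Func.oplus => fun v => stdOplus (v 0) (v 1)
  RelMap r := r.elim

/-! ### MV-algebras and Riesz MV-algebras -/

/-- The reduct `(A, ⊕, *, 0)` is an MV-algebra: an abelian monoid satisfying the three
MV-identities. -/
structure IsMVAlgebra (A : Type*) [lang.Structure A] : Prop where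
  oplus_assoc : ∀ x y z : A, oplus (oplus x y) z = oplus x (oplus y z)
  oplus_comm : ∀ x y : A, oplus x y = oplus y x
  oplus_zero : ∀ x : A, oplus x (zero A) = x
  neg_neg : ∀ x : A, neg (neg x) = x
  neg_zero_oplus : ∀ x : A, oplus (neg (zero A)) x = neg (zero A)
  lukasiewicz : ∀ x y : A,
    oplus (neg (oplus (neg x) y)) y = oplus (neg (oplus (neg y) x)) x

/-- Riesz MV-algebras. In `smul_scalar`, the expression `odot r (neg q)` is computed in the standard
algebra `[0,1]`, and in `smul_smul` the expression `r * q` is the product of real numbers. -/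
structure IsRieszMVAlgebra (R : Type*) [lang.Structure R] : Prop extends IsMVAlgebra R where
  smul_odot : ∀ (r : unitInterval) (x y : R),
    smul r (odot x (neg y)) = odot (smul r x) (neg (smul r y))
  smul_scalar : ∀ (r q : unitInterval) (x : R),
    smul (odot r (neg q)) x = odot (smul r x) (neg (smul q x))
  smul_smul : ∀ (r q : unitInterval) (x : R), smul r (smul q x) = smul (r * q) x
  one_smul : ∀ x : R, smul 1 x = x

/-! ### Equations -/

/-- The equation `t = s` (in the variables `v₀, v₁, v₂, …`) holds in the algebra `A`: the two terms
take the same value under every assignment of the variables in `A`. -/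
def HoldsIn (A : Type*) [lang.Structure A] (t s : lang.Term ℕ) : Prop :=
  ∀ v : ℕ → A, t.realize v = s.realize v

/-! ### Varieties -/

/-- The direct product of a family of algebras, with componentwise operations. -/
instance piStructure {ι : Type*} (A : ι → Type*) [∀ i, lang.Structure (A i)] :
    lang.Structure (∀ i, A i) where
  funMap f v := fun i => FirstOrder.Language.Structure.funMap f (fun j => v j i)
  RelMap r := r.elim

/-- A class of algebras is a variety if it is closed under homomorphic images, subalgebras and
direct products. -/
structure IsVariety (K : Set (CategoryTheory.Bundled.{u} lang.Structure)) : Prop where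
  image : ∀ (A B : CategoryTheory.Bundled.{u} lang.Structure) (f : A →[lang] B),
    Function.Surjective f → A ∈ K → B ∈ K
  sub : ∀ (A : CategoryTheory.Bundled.{u} lang.Structure) (S : lang.Substructure A),
    A ∈ K → CategoryTheory.Bundled.of (c := lang.Structure) S ∈ K
  prod : ∀ (ι : Type u) (A : ι → CategoryTheory.Bundled.{u} lang.Structure),
    (∀ i, A i ∈ K) → CategoryTheory.Bundled.of (c := lang.Structure) (∀ i, A i) ∈ K

/-- The variety generated by an algebra `A`: the smallest class of algebras (with carriers in a given
universe) that is a variety and contains all isomorphic copies of `A`. -/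
def generatedVariety (A : Type) [lang.Structure A] : Set (CategoryTheory.Bundled.{u} lang.Structure) :=
  ⋂₀ {K | IsVariety K ∧
    ∀ B : CategoryTheory.Bundled.{u} lang.Structure, Nonempty (B ≃[lang] A) → B ∈ K}

/-- The class of all Riesz MV-algebras. -/
def rieszMVAlgebras : Set (CategoryTheory.Bundled.{u} lang.Structure) :=
  {R | IsRieszMVAlgebra R}

end RieszMV

namespace RieszMV

set_option linter.unusedSectionVars false

/-! ### Order and arithmetic of MV-algebras -/

section MV

variable {A : Type*} [lang.Structure A]

instance [Fact (IsMVAlgebra A)] : Zero A := ⟨zero A⟩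

instance [Fact (IsMVAlgebra A)] : Add A := ⟨oplus⟩

/-- The truncated difference `x ⊙ y*`. -/
instance [Fact (IsMVAlgebra A)] : Sub A := ⟨fun x y => odot x (neg y)⟩

variable [hA : Fact (IsMVAlgebra A)]

instance : AddCommMonoid A where
  add_assoc := hA.out.oplus_assoc
  add_comm := hA.out.oplus_comm
  add_zero := hA.out.oplus_zero
  zero_add x := (hA.out.oplus_comm _ _).trans (hA.out.oplus_zero x)
  nsmul := nsmulRec

theorem zero_eq : zero A = 0 := rfl

theorem odot_neg_eq_sub (x y : A) : odot x (neg y) = x - y := rfl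

theorem neg_neg' (x : A) : neg (neg x) = x := hA.out.neg_neg x

theorem neg_zero_add (x : A) : neg 0 + x = neg (0 : A) := hA.out.neg_zero_oplus x

theorem add_neg_zero (x : A) : x + neg 0 = neg (0 : A) := by rw [add_comm, neg_zero_add]

theorem lukasiewicz (x y : A) : neg (neg x + y) + y = neg (neg y + x) + x :=
  hA.out.lukasiewicz x y

theorem sub_eq (x y : A) : x - y = neg (neg x + y) := by
  change neg (oplus (neg x) (neg (neg y))) = _
  rw [neg_neg']; rfl

theorem neg_add_self (x : A) : neg x + x = neg (0 : A) := by
  have h := lukasiewicz x (neg 0)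
  rwa [add_neg_zero, neg_neg', zero_add, eq_comm] at h

theorem sub_eq_zero_iff (x y : A) : x - y = 0 ↔ neg x + y = neg (0 : A) := by
  rw [sub_eq]
  constructor
  · intro h; rw [← h, neg_neg']
  · intro h; rw [h, neg_neg']

theorem sub_add_eq_of_sub_eq_zero {x y : A} (h : x - y = 0) : y - x + x = y := by
  rw [sub_eq_zero_iff] at h
  rw [sub_eq, lukasiewicz, h, neg_neg', zero_add]

theorem sub_add_self_eq_zero (x z : A) : x - (x + z) = 0 := by
  rw [sub_eq_zero_iff, ← add_assoc, neg_add_self, neg_zero_add]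

instance : PartialOrder A where
  le x y := x - y = 0
  le_refl x := by simpa using sub_add_self_eq_zero x 0
  le_trans x y z h h' := by
    rw [← sub_add_eq_of_sub_eq_zero h', ← sub_add_eq_of_sub_eq_zero h, add_comm _ x,
      add_left_comm]
    exact sub_add_self_eq_zero _ _
  le_antisymm x y h h' := by
    have := sub_add_eq_of_sub_eq_zero h
    rwa [show y - x = 0 from h', zero_add] at this

theorem le_iff_sub_eq_zero {x y : A} : x ≤ y ↔ x - y = 0 := Iff.rfl

theorem le_iff_neg_add {x y : A} : x ≤ y ↔ neg x + y = neg (0 : A) := sub_eq_zero_iff x y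

instance : CanonicallyOrderedAdd A where
  exists_add_of_le {a b} h := ⟨b - a, by rw [add_comm, sub_add_eq_of_sub_eq_zero h]⟩
  le_add_self a b := by rw [add_comm]; exact sub_add_self_eq_zero _ _
  le_self_add a b := sub_add_self_eq_zero _ _

instance : IsOrderedAddMonoid A where
  add_le_add_left a b h c := by
    obtain ⟨d, rfl⟩ := exists_add_of_le h
    rw [add_right_comm]
    exact le_self_add

instance : OrderedSub A where
  tsub_le_iff_right x y z := by
    rw [le_iff_neg_add, le_iff_neg_add, sub_eq, neg_neg', add_assoc, add_comm y]

theorem le_neg_zero (x : A) : x ≤ neg 0 := by rw [le_iff_neg_add, add_neg_zero]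

theorem neg_zero_sub (x : A) : neg 0 - x = neg x := by rw [sub_eq, neg_neg', zero_add]

theorem neg_antitone {x y : A} (h : x ≤ y) : neg y ≤ neg x := by
  rw [← neg_zero_sub, ← neg_zero_sub x]
  exact tsub_le_tsub_left h _

theorem le_neg_comm {x y : A} : x ≤ neg y ↔ y ≤ neg x := by
  rw [le_iff_neg_add, le_iff_neg_add, add_comm]

theorem add_sub_cancel_of_le_neg {x y : A} (h : x ≤ neg y) : x + y - y = x := by
  have h' := lukasiewicz (neg x) y
  rw [le_iff_neg_add] at h
  rw [neg_neg', add_comm (neg y), h, neg_neg', zero_add] at h'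
  rw [sub_eq, h', neg_neg']

theorem le_of_add_le_add {x y z : A} (hx : x ≤ neg z) (hy : y ≤ neg z) (h : x + z ≤ y + z) :
    x ≤ y := by
  rw [← add_sub_cancel_of_le_neg hx, ← add_sub_cancel_of_le_neg hy]
  exact tsub_le_tsub_right h _

theorem add_eq_neg_zero {x y : A} (h : neg y ≤ x) : x + y = neg 0 := by
  rw [le_iff_neg_add, neg_neg', add_comm] at h
  exact h

theorem sub_le_neg (x y : A) : x - y ≤ neg y := by
  rw [← neg_zero_sub]
  exact tsub_le_tsub_right (le_neg_zero x) y

theorem sub_sub_cancel_of_le {x y : A} (h : x ≤ y) : y - (y - x) = x := by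
  have h' := add_sub_cancel_of_le_neg (le_neg_comm.1 (sub_le_neg y x))
  rwa [add_comm, tsub_add_cancel_of_le h] at h'

theorem le_sub_sub {x y z : A} (hx : z ≤ x) (hy : z ≤ y) : z ≤ x - (x - y) := by
  rw [← sub_sub_cancel_of_le hx]
  exact tsub_le_tsub_left (tsub_le_tsub_left hy x) x

/-- The truncated differences `x ⊙ y*` and `y ⊙ x*` are disjoint. -/
theorem eq_zero_of_le_sub_of_le_sub {x y z : A} (h : z ≤ x - y) (h' : z ≤ y - x) : z = 0 := by
  -- `m` is the meet of `x` and `y`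
  set m := x - (x - y) with hm
  have hxy : x - y ≤ x := tsub_le_self
  have hmy' : y - (y - x) = m := by
    have h1 := lukasiewicz (neg x) (neg y)
    rw [hm, sub_eq, sub_eq, sub_eq, sub_eq]
    rw [neg_neg', neg_neg'] at h1
    rw [add_comm (neg y) (neg _), add_comm (neg x) (neg (neg x + y)), add_comm (neg x) y,
      add_comm (neg y) x, h1]
  have hzm : z ≤ neg m := le_neg_comm.1 ((sub_le_neg x _).trans (neg_antitone h))
  have h1 : z + m ≤ x := by
    calc z + m ≤ (x - y) + m := by gcongr
      _ = x := by rw [hm, add_comm]; exact tsub_add_cancel_of_le hxy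
  have h2 : z + m ≤ y := by
    calc z + m ≤ (y - x) + m := by gcongr
      _ = y := by rw [← hmy', add_comm]; exact tsub_add_cancel_of_le tsub_le_self
  have h3 : z + m ≤ 0 + m := by
    rw [zero_add]
    exact le_sub_sub h1 h2
  exact nonpos_iff_eq_zero.1 (le_of_add_le_add hzm zero_le h3)

end MV
/-! ### Scalar multiplication in Riesz MV-algebras -/

section Riesz

variable {A : Type*} [lang.Structure A]

instance [h : Fact (IsRieszMVAlgebra A)] : Fact (IsMVAlgebra A) := ⟨h.out.toIsMVAlgebra⟩

variable [hA : Fact (IsRieszMVAlgebra A)]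

theorem smul_sub (r : unitInterval) (x y : A) : smul r (x - y) = smul r x - smul r y :=
  hA.out.smul_odot r x y

theorem coe_odot_neg (r q : unitInterval) : ((odot r (neg q) : unitInterval) : ℝ) = max 0 ((r : ℝ) - q) := by
  change 1 - min 1 ((1 - (r : ℝ)) + (1 - (1 - (q : ℝ)))) = _
  rw [max_def, min_def]
  split_ifs <;> linarith

theorem sub_smul {r q p : unitInterval} (h : (r : ℝ) = p + q) (x : A) :
    smul p x = smul r x - smul q x := by
  rw [← odot_neg_eq_sub (smul r x), ← hA.out.smul_scalar]
  congr 1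
  ext
  rw [coe_odot_neg, h, add_sub_cancel_right, max_eq_right p.2.1]

theorem smul_smul' (r q : unitInterval) (x : A) : smul r (smul q x) = smul (r * q) x :=
  hA.out.smul_smul r q x

theorem one_smul' (x : A) : smul 1 x = x := hA.out.one_smul x

theorem smul_zero' (r : unitInterval) : smul r (0 : A) = 0 := by
  rw [← tsub_self (0 : A), smul_sub, tsub_self, tsub_self]

theorem zero_smul' (x : A) : smul 0 x = 0 := by
  rw [sub_smul (r := 0) (q := 0) (p := 0) (by simp) x, tsub_self]

theorem smul_mono (r : unitInterval) {x y : A} (h : x ≤ y) : smul r x ≤ smul r y := by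
  rw [le_iff_sub_eq_zero] at h ⊢
  rw [← smul_sub, h, smul_zero']

theorem smul_mono_left {r q : unitInterval} (h : r ≤ q) (x : A) : smul r x ≤ smul q x := by
  have h' : (q : ℝ) - r ∈ unitInterval :=
    ⟨sub_nonneg.2 h, by linarith [q.2.2, r.2.1]⟩
  rw [sub_smul (r := q) (q := ⟨_, h'⟩) (p := r) (by simp)]
  exact tsub_le_self

theorem smul_le_self (r : unitInterval) (x : A) : smul r x ≤ x :=
  (smul_mono_left r.2.2 x).trans_eq (one_smul' x)

theorem add_smul {r q p : unitInterval} (h : (p : ℝ) = r + q) (x : A) :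
    smul p x = smul r x + smul q x := by
  have hqp : q ≤ p := by
    change (q : ℝ) ≤ p
    linarith [r.2.1]
  rw [sub_smul h, tsub_add_cancel_of_le (smul_mono_left hqp x)]

theorem smul_add_of_le_neg (r : unitInterval) {x y : A} (h : x ≤ neg y) :
    smul r (x + y) = smul r x + smul r y := by
  conv_rhs => rw [← add_sub_cancel_of_le_neg h, smul_sub]
  rw [tsub_add_cancel_of_le (smul_mono r le_add_self)]

/-- Elements bounded by complementary multiples of `1` have an exact sum. -/
theorem le_neg_of_le_smul {p q : unitInterval} (hpq : (p : ℝ) + q ≤ 1) {x y : A}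
    (hx : x ≤ smul p (neg 0)) (hy : y ≤ smul q (neg 0)) : x ≤ neg y := by
  have h : smul (unitInterval.symm q) (neg (0 : A)) = neg (smul q (neg 0)) := by
    rw [sub_smul (r := 1) (q := q) (by simp), one_smul', neg_zero_sub]
  refine hx.trans (le_trans ?_ (neg_antitone hy))
  rw [← h]
  refine smul_mono_left ?_ _
  change (p : ℝ) ≤ 1 - q
  linarith

theorem eq_zero_of_smul_eq_zero {r : unitInterval} (hr : 0 < r) {x : A} (h : smul r x = 0) :
    x = 0 := by
  obtain ⟨n, hn⟩ := exists_nat_one_div_lt (show (0 : ℝ) < r from hr)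
  have hn0 : (0 : ℝ) < n + 1 := by positivity
  have key : ∀ k : ℕ, ∀ hk : (k : ℝ) / (n + 1) ∈ unitInterval,
      smul ⟨_, hk⟩ x = 0 := by
    intro k
    induction k with
    | zero =>
      intro hk
      rw [← zero_smul' x]
      congr 1
      ext
      simp
    | succ k ih =>
      intro hk
      have hk' : (k : ℝ) / (n + 1) ∈ unitInterval := by
        refine ⟨by positivity, le_trans ?_ hk.2⟩
        gcongr
        simp
      have h1 : (1 : ℝ) / (n + 1) ∈ unitInterval :=
        ⟨by positivity, hn.le.trans r.2.2⟩
      rw [add_smul (r := ⟨_, hk'⟩) (q := ⟨_, h1⟩) (by push_cast; ring), ih, zero_add]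
      exact nonpos_iff_eq_zero.1 ((smul_mono_left (show _ ≤ r from hn.le) x).trans_eq h)
  have := key (n + 1) (by push_cast; rw [div_self hn0.ne']; exact ⟨zero_le_one, le_rfl⟩)
  rw [← one_smul' x, ← this]
  congr 1
  ext
  push_cast
  rw [div_self hn0.ne']

theorem le_of_smul_le_smul {r : unitInterval} (hr : 0 < r) {x y : A}
    (h : smul r x ≤ smul r y) : x ≤ y := by
  rw [le_iff_sub_eq_zero] at h ⊢
  rw [← smul_sub] at h
  exact eq_zero_of_smul_eq_zero hr h

end Riesz

/-! ### Closure properties of the class of Riesz MV-algebras -/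

section Closure

open FirstOrder.Language

variable {A : Type*} {B : Type*} [lang.Structure A] [lang.Structure B]

theorem map_zero' (f : A →[lang] B) : f (zero A) = zero B :=
  (f.map_fun _ _).trans (congrArg _ (Subsingleton.elim _ _))

theorem map_neg' (f : A →[lang] B) (x : A) : f (neg x) = neg (f x) :=
  (f.map_fun _ _).trans (congrArg _ (funext fun i => by fin_cases i; rfl))

theorem map_smul' (f : A →[lang] B) (r : unitInterval) (x : A) : f (smul r x) = smul r (f x) :=
  (f.map_fun _ _).trans (congrArg _ (funext fun i => by fin_cases i; rfl))

theorem map_oplus' (f : A →[lang] B) (x y : A) : f (oplus x y) = oplus (f x) (f y) :=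
  (f.map_fun _ _).trans (congrArg _ (funext fun i => by fin_cases i <;> rfl))

theorem map_odot' (f : A →[lang] B) (x y : A) : f (odot x y) = odot (f x) (f y) := by
  simp only [odot, map_neg', map_oplus']

theorem IsRieszMVAlgebra.of_surjective (h : IsRieszMVAlgebra A) (f : A →[lang] B)
    (hf : Function.Surjective f) : IsRieszMVAlgebra B where
  oplus_assoc x y z := by
    obtain ⟨x, rfl⟩ := hf x
    obtain ⟨y, rfl⟩ := hf y
    obtain ⟨z, rfl⟩ := hf z
    simp only [← map_oplus', h.oplus_assoc]
  oplus_comm x y := by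
    obtain ⟨x, rfl⟩ := hf x
    obtain ⟨y, rfl⟩ := hf y
    simp only [← map_oplus', h.oplus_comm x y]
  oplus_zero x := by
    obtain ⟨x, rfl⟩ := hf x
    simp only [← map_oplus', ← map_zero' f, h.oplus_zero]
  neg_neg x := by
    obtain ⟨x, rfl⟩ := hf x
    simp only [← map_neg', h.neg_neg]
  neg_zero_oplus x := by
    obtain ⟨x, rfl⟩ := hf x
    simp only [← map_oplus', ← map_neg', ← map_zero' f, h.neg_zero_oplus]
  lukasiewicz x y := by
    obtain ⟨x, rfl⟩ := hf x
    obtain ⟨y, rfl⟩ := hf y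
    simp only [← map_oplus', ← map_neg', h.lukasiewicz x y]
  smul_odot r x y := by
    obtain ⟨x, rfl⟩ := hf x
    obtain ⟨y, rfl⟩ := hf y
    simp only [← map_odot', ← map_neg', ← map_smul', h.smul_odot]
  smul_scalar r q x := by
    obtain ⟨x, rfl⟩ := hf x
    simp only [← map_odot', ← map_neg', ← map_smul', h.smul_scalar]
  smul_smul r q x := by
    obtain ⟨x, rfl⟩ := hf x
    simp only [← map_smul', h.smul_smul]
  one_smul x := by
    obtain ⟨x, rfl⟩ := hf x
    simp only [← map_smul', h.one_smul]

/-- An algebra with a point-separating family of homomorphisms into Riesz MV-algebras is a Riesz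
MV-algebra. -/
theorem IsRieszMVAlgebra.of_separating {ι : Sort*} {C : ι → Type*} [∀ i, lang.Structure (C i)]
    (h : ∀ i, IsRieszMVAlgebra (C i)) (f : ∀ i, B →[lang] C i)
    (hf : ∀ x y : B, (∀ i, f i x = f i y) → x = y) : IsRieszMVAlgebra B where
  oplus_assoc x y z := hf _ _ fun i => by simp only [map_oplus', (h i).oplus_assoc]
  oplus_comm x y := hf _ _ fun i => by simp only [map_oplus', (h i).oplus_comm (f i x)]
  oplus_zero x := hf _ _ fun i => by simp only [map_oplus', map_zero', (h i).oplus_zero]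
  neg_neg x := hf _ _ fun i => by simp only [map_neg', (h i).neg_neg]
  neg_zero_oplus x := hf _ _ fun i => by
    simp only [map_oplus', map_zero', map_neg', (h i).neg_zero_oplus]
  lukasiewicz x y := hf _ _ fun i => by
    simp only [map_oplus', map_neg', (h i).lukasiewicz (f i x)]
  smul_odot r x y := hf _ _ fun i => by
    simp only [map_odot', map_neg', map_smul', (h i).smul_odot]
  smul_scalar r q x := hf _ _ fun i => by
    simp only [map_odot', map_neg', map_smul', (h i).smul_scalar]
  smul_smul r q x := hf _ _ fun i => by simp only [map_smul', (h i).smul_smul]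
  one_smul x := hf _ _ fun i => by simp only [map_smul', (h i).one_smul]

theorem coe_oplus (x y : unitInterval) : ((oplus x y : unitInterval) : ℝ) = min 1 (x + y : ℝ) := rfl

theorem coe_neg (x : unitInterval) : ((neg x : unitInterval) : ℝ) = 1 - x := rfl

theorem coe_smul (r x : unitInterval) : ((smul r x : unitInterval) : ℝ) = r * x := rfl

theorem coe_zero : ((zero unitInterval : unitInterval) : ℝ) = 0 := rfl

theorem isRieszMVAlgebra_unitInterval : IsRieszMVAlgebra unitInterval where
  oplus_assoc x y z := by
    ext
    simp only [coe_oplus, min_def]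
    have := x.2.1; have := y.2.1; have := z.2.1
    split_ifs <;> linarith
  oplus_comm x y := by ext; simp only [coe_oplus, add_comm]
  oplus_zero x := by ext; simp only [coe_oplus, coe_zero, add_zero, min_eq_right x.2.2]
  neg_neg x := by ext; simp only [coe_neg, sub_sub_cancel]
  neg_zero_oplus x := by
    ext
    simp only [coe_oplus, coe_neg, coe_zero, sub_zero]
    exact min_eq_left (by linarith [x.2.1])
  lukasiewicz x y := by
    ext
    simp only [coe_oplus, coe_neg, min_def]
    have := x.2; have := y.2
    have := x.2.1; have := y.2.1; have := x.2.2; have := y.2.2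
    split_ifs <;> linarith
  smul_odot r x y := by
    ext
    simp only [coe_odot_neg, coe_smul, mul_max_of_nonneg _ _ r.2.1, mul_zero, mul_sub]
  smul_scalar r q x := by
    ext
    simp only [coe_odot_neg, coe_smul, max_mul_of_nonneg _ _ x.2.1, zero_mul, sub_mul]
  smul_smul r q x := by ext; simp only [coe_smul, Set.Icc.coe_mul, mul_assoc]
  one_smul x := by ext; simp only [coe_smul, Set.Icc.coe_one, one_mul]

end Closure
/-! ### Ideals and totally ordered quotients -/

section Ideals

variable {A : Type*} [lang.Structure A]

/-- An ideal of an MV-algebra. -/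
structure IsIdeal [Fact (IsMVAlgebra A)] (I : Set A) : Prop where
  zero_mem : 0 ∈ I
  mem_of_le : ∀ {x y : A}, x ≤ y → y ∈ I → x ∈ I
  add_mem : ∀ {x y : A}, x ∈ I → y ∈ I → x + y ∈ I

section MV

variable [Fact (IsMVAlgebra A)]

theorem IsIdeal.adjoin {I : Set A} (h : IsIdeal I) (a : A) :
    IsIdeal {z | ∃ i ∈ I, ∃ n : ℕ, z ≤ i + n • a} where
  zero_mem := ⟨0, h.zero_mem, 0, zero_le⟩
  mem_of_le := by
    rintro x y hxy ⟨i, hi, n, hy⟩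
    exact ⟨i, hi, n, hxy.trans hy⟩
  add_mem := by
    rintro x y ⟨i, hi, n, hx⟩ ⟨j, hj, m, hy⟩
    refine ⟨i + j, h.add_mem hi hj, n + m, (add_le_add hx hy).trans_eq ?_⟩
    rw [add_nsmul, add_add_add_comm]

theorem eq_zero_of_le_nsmul_of_le {a b : A} (h : ∀ z, z ≤ a → z ≤ b → z = 0) (n : ℕ) :
    ∀ z, z ≤ n • a → z ≤ b → z = 0 := by
  induction n with
  | zero =>
    intro z hz _
    rw [zero_nsmul] at hz
    exact nonpos_iff_eq_zero.1 hz
  | succ n ih =>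
    intro z hz hb
    rw [succ_nsmul, ← tsub_le_iff_left] at hz
    refine ih z ?_ hb
    rw [le_iff_sub_eq_zero]
    exact h _ hz (tsub_le_self.trans hb)

/-- An ideal that is maximal among those avoiding a given element is prime. -/
theorem sub_mem_or_sub_mem_of_maximal {d : A} {I : Set A}
    (h : Maximal (fun J : Set A => IsIdeal J ∧ d ∉ J) I) (x y : A) : x - y ∈ I ∨ y - x ∈ I := by
  have key : ∀ a ∉ I, ∃ i ∈ I, ∃ n : ℕ, d ≤ i + n • a := by
    intro a ha
    by_contra hd
    refine ha (h.le_of_ge (y := {z | ∃ i ∈ I, ∃ n : ℕ, z ≤ i + n • a})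
      ⟨h.prop.1.adjoin a, hd⟩ ?_ ?_)
    · exact fun i hi => ⟨i, hi, 0, le_self_add⟩
    · exact ⟨0, h.prop.1.zero_mem, 1, by rw [one_nsmul, zero_add]⟩
  by_contra! hxy
  obtain ⟨i, hi, n, hn⟩ := key _ hxy.1
  obtain ⟨j, hj, m, hm⟩ := key _ hxy.2
  have h1 : d - (i + j) ≤ n • (x - y) := by
    rw [tsub_le_iff_left]
    exact hn.trans (by gcongr; exact le_self_add)
  have h2 : d - (i + j) ≤ m • (y - x) := by
    rw [tsub_le_iff_left]
    exact hm.trans (by gcongr; exact le_add_self)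
  have h3 : d - (i + j) = 0 :=
    eq_zero_of_le_nsmul_of_le
      (fun z hz hz' => eq_zero_of_le_nsmul_of_le
        (fun z hz hz' => eq_zero_of_le_sub_of_le_sub hz' hz) m z hz' hz) n _ h1 h2
  exact h.prop.2 (h.prop.1.mem_of_le h3 (h.prop.1.add_mem hi hj))

theorem exists_maximal_ideal_notMem {d : A} (hd : d ≠ 0) :
    ∃ I, Maximal (fun J : Set A => IsIdeal J ∧ d ∉ J) I := by
  have h0 : IsIdeal {(0 : A)} ∧ d ∉ ({0} : Set A) := by
    refine ⟨⟨rfl, ?_, ?_⟩, hd⟩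
    · rintro x y hxy rfl
      exact nonpos_iff_eq_zero.1 hxy
    · rintro x y rfl rfl
      exact add_zero _
  have hchain : ∀ c ⊆ {J : Set A | IsIdeal J ∧ d ∉ J}, IsChain (· ⊆ ·) c → c.Nonempty →
      ∃ ub ∈ {J : Set A | IsIdeal J ∧ d ∉ J}, ∀ s ∈ c, s ⊆ ub := by
    intro c hc hchain ⟨J, hJ⟩
    refine ⟨⋃₀ c, ⟨⟨⟨J, hJ, (hc hJ).1.zero_mem⟩, ?_, ?_⟩, ?_⟩, fun s hs =>
      Set.subset_sUnion_of_mem hs⟩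
    · rintro x y hxy ⟨K, hK, hy⟩
      exact ⟨K, hK, (hc hK).1.mem_of_le hxy hy⟩
    · rintro x y ⟨K, hK, hx⟩ ⟨L, hL, hy⟩
      rcases hchain.total hK hL with h | h
      · exact ⟨L, hL, (hc hL).1.add_mem (h hx) hy⟩
      · exact ⟨K, hK, (hc hK).1.add_mem hx (h hy)⟩
    · rintro ⟨K, hK, hd⟩
      exact (hc hK).2 hd
  obtain ⟨I, -, hI⟩ := zorn_subset_nonempty _ hchain _ h0
  exact ⟨I, hI⟩

/-- The congruence defined by an ideal. -/
def IsIdeal.setoid {I : Set A} (h : IsIdeal I) : Setoid A where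
  r x y := x - y ∈ I ∧ y - x ∈ I
  iseqv :=
    { refl := fun x => by rw [tsub_self]; exact ⟨h.zero_mem, h.zero_mem⟩
      symm := And.symm
      trans := fun hxy hyz =>
        ⟨h.mem_of_le tsub_le_tsub_add_tsub (h.add_mem hxy.1 hyz.1),
          h.mem_of_le tsub_le_tsub_add_tsub (h.add_mem hyz.2 hxy.2)⟩ }

theorem neg_sub_neg' (x y : A) : neg x - neg y = y - x := by
  rw [sub_eq, sub_eq, neg_neg', add_comm]

end MV

/-- The congruence of an ideal of a Riesz MV-algebra is compatible with all operations. -/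
@[reducible]
def IsIdeal.prestructure [Fact (IsRieszMVAlgebra A)] {I : Set A} (h : IsIdeal I) :
    lang.Prestructure h.setoid where
  toStructure := inferInstance
  fun_equiv {n} f x y hxy := by
    cases f with
    | zero => rw [Subsingleton.elim x y]
    | neg =>
      have h0 := hxy 0
      have e : ∀ z : Fin 1 → A, FirstOrder.Language.Structure.funMap (L := lang) Func.neg z
          = neg (z 0) := fun z => congrArg _ (funext fun i => by fin_cases i; rfl)
      rw [e, e]
      change _ ∈ I ∧ _ ∈ I
      rw [neg_sub_neg', neg_sub_neg']
      exact h0.symm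
    | scal r =>
      have h0 := hxy 0
      have e : ∀ z : Fin 1 → A, FirstOrder.Language.Structure.funMap (L := lang) (Func.scal r) z
          = smul r (z 0) := fun z => congrArg _ (funext fun i => by fin_cases i; rfl)
      rw [e, e]
      change _ ∈ I ∧ _ ∈ I
      rw [← smul_sub, ← smul_sub]
      exact ⟨h.mem_of_le (smul_le_self _ _) h0.1, h.mem_of_le (smul_le_self _ _) h0.2⟩
    | oplus =>
      have h0 := hxy 0
      have h1 := hxy 1
      have e : ∀ z : Fin 2 → A, FirstOrder.Language.Structure.funMap (L := lang) Func.oplus z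
          = z 0 + z 1 := fun z => congrArg _ (funext fun i => by fin_cases i <;> rfl)
      rw [e, e]
      exact ⟨h.mem_of_le add_tsub_add_le_tsub_add_tsub (h.add_mem h0.1 h1.1),
        h.mem_of_le add_tsub_add_le_tsub_add_tsub (h.add_mem h0.2 h1.2)⟩
  rel_equiv {n} r := r.elim

end Ideals

/-- Distinct elements of a Riesz MV-algebra stay distinct in some totally ordered quotient. -/
theorem exists_chain_quotient {A : Type u} [lang.Structure A] (hA : IsRieszMVAlgebra A) {x y : A}
    (hxy : x ≠ y) :
    ∃ (B : Type u) (_ : lang.Structure B) (f : A →[lang] B), IsRieszMVAlgebra B ∧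
      (∀ b c : B, odot b (neg c) = zero B ∨ odot c (neg b) = zero B) ∧ f x ≠ f y := by
  have : Fact (IsRieszMVAlgebra A) := ⟨hA⟩
  obtain ⟨d, hd, hd'⟩ : ∃ d : A, d ≠ 0 ∧ (d = x - y ∨ d = y - x) := by
    by_cases h : x - y = 0
    · exact ⟨y - x, fun h' => hxy (le_antisymm h h'), Or.inr rfl⟩
    · exact ⟨_, h, Or.inl rfl⟩
  obtain ⟨I, hI⟩ := exists_maximal_ideal_notMem hd
  have hI' := hI.prop.1
  let _ := hI'.prestructure
  let f : A →[lang] Quotient hI'.setoid :=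
    { toFun := fun a => ⟦a⟧
      map_fun' := fun F v => (FirstOrder.Language.funMap_quotient_mk' hI'.setoid F v).symm
      map_rel' := fun r => r.elim }
  have hf : Function.Surjective f := Quotient.mk_surjective
  refine ⟨Quotient hI'.setoid, inferInstance, f, hA.of_surjective f hf, ?_, ?_⟩
  · have key : ∀ z ∈ I, f z = zero _ := by
      intro z hz
      rw [← map_zero' f]
      refine Quotient.sound ⟨hI'.mem_of_le tsub_le_self hz, ?_⟩
      rw [zero_eq, zero_tsub]
      exact hI'.zero_mem
    intro b c
    obtain ⟨b, rfl⟩ := hf b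
    obtain ⟨c, rfl⟩ := hf c
    rw [← map_neg', ← map_neg', ← map_odot', ← map_odot']
    exact (sub_mem_or_sub_mem_of_maximal hI b c).imp (key _) (key _)
  · intro h
    have h' := Quotient.exact h
    rcases hd' with rfl | rfl
    · exact hI.prop.2 h'.1
    · exact hI.prop.2 h'.2

/-! ### Separation from the lineality space of a cone -/

/-- A linear functional that vanishes on the lineality space of a convex cone and is positive at
finitely many given elements of the cone outside of this space. -/
theorem exists_linear_pos_of_finite {E : Type*} [NormedAddCommGroup E] [NormedSpace ℝ E]
    [FiniteDimensional ℝ E] (K : ConvexCone ℝ E) (hK : (0 : E) ∈ K) {F : Set E} (hF : F.Finite)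
    (hFK : ∀ c ∈ F, c ∈ K ∧ -c ∉ K) :
    ∃ φ : E →ₗ[ℝ] ℝ, (∀ c ∈ K, -c ∈ K → φ c = 0) ∧ ∀ c ∈ F, 0 < φ c := by
  have hsmul : ∀ (r : ℝ), 0 ≤ r → ∀ c ∈ K, r • c ∈ K := by
    intro r hr c hc
    rcases hr.eq_or_lt with rfl | hr
    · rwa [zero_smul]
    · exact K.smul_mem hr hc
  let N : Submodule ℝ E :=
    { carrier := {c | c ∈ K ∧ -c ∈ K}
      zero_mem' := ⟨hK, by rwa [neg_zero]⟩
      add_mem' := fun {x y} hx hy => ⟨K.add_mem hx.1 hy.1, by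
        rw [neg_add]; exact K.add_mem hx.2 hy.2⟩
      smul_mem' := fun r x hx => by
        rcases le_total 0 r with hr | hr
        · exact ⟨hsmul r hr x hx.1, by rw [← smul_neg]; exact hsmul r hr _ hx.2⟩
        · have hr' := neg_nonneg.2 hr
          exact ⟨by rw [← neg_smul_neg]; exact hsmul _ hr' _ hx.2,
            by rw [← neg_smul]; exact hsmul _ hr' _ hx.1⟩ }
  have hconv : Convex ℝ {c | c ∈ K ∧ -c ∉ K} := by
    have key : ∀ x y, x ∈ K → -x ∉ K → y ∈ K → -(x + y) ∉ K := fun x y _ hx' hy h =>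
      hx' (by have := K.add_mem h hy; rwa [neg_add, neg_add_cancel_right] at this)
    intro x hx y hy p q hp hq hpq
    refine ⟨K.convex hx.1 hy.1 hp hq hpq, ?_⟩
    rcases hp.eq_or_lt with rfl | hp'
    · rw [zero_add] at hpq
      rw [hpq, zero_smul, zero_add, one_smul]
      exact hy.2
    · refine key _ _ (K.smul_mem hp' hx.1) ?_ (hsmul q hq y hy.1)
      intro h
      have := K.smul_mem (inv_pos.2 hp') h
      rw [smul_neg, _root_.smul_smul, inv_mul_cancel₀ hp'.ne', _root_.one_smul] at this
      exact hx.2 this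
  have hdisj : Disjoint (convexHull ℝ F) (N : Set E) := by
    rw [Set.disjoint_left]
    intro c hc hcN
    exact (convexHull_min hFK hconv hc).2 hcN.2
  obtain ⟨f, u, v, hfu, huv, hfv⟩ := geometric_hahn_banach_compact_closed (convex_convexHull ℝ F)
    (hF.isCompact_convexHull ℝ) N.convex N.closed_of_finiteDimensional hdisj
  have hv : v < 0 := by simpa using hfv 0 N.zero_mem
  refine ⟨-f.toLinearMap, fun c hc hc' => ?_, fun c hc => ?_⟩
  · by_contra hne
    have hne' : f c ≠ 0 := fun h => hne (by simp [h])
    have := hfv _ (N.smul_mem (v / f c) (show c ∈ N from ⟨hc, hc'⟩))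
    rw [map_smul, smul_eq_mul, div_mul_cancel₀ _ hne'] at this
    exact lt_irrefl _ this
  · have := hfu c (subset_convexHull ℝ F hc)
    simp only [LinearMap.neg_apply, ContinuousLinearMap.coe_coe]
    linarith

/-! ### Small linear combinations in a Riesz MV-algebra -/

section Comb

variable {A : Type*} [lang.Structure A] [Fact (IsRieszMVAlgebra A)]

/-- The scalar in `[0,1]` closest to a real number. -/
noncomputable def clip (r : ℝ) : unitInterval := Set.projIcc 0 1 zero_le_one r

theorem coe_clip {r : ℝ} (h : 0 ≤ r) (h' : r ≤ 1) : ((clip r : unitInterval) : ℝ) = r := by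
  rw [clip, Set.projIcc_of_mem _ ⟨h, h'⟩]

theorem clip_coe (r : unitInterval) : clip r = r := Set.projIcc_val _ r

theorem clip_zero : clip 0 = 0 := clip_coe 0

theorem clip_add_smul {r q : ℝ} (hr : 0 ≤ r) (hq : 0 ≤ q) (h : r + q ≤ 1) (x : A) :
    smul (clip (r + q)) x = smul (clip r) x + smul (clip q) x :=
  add_smul (by rw [coe_clip (add_nonneg hr hq) h, coe_clip hr (by linarith),
    coe_clip hq (by linarith)]) x

theorem clip_mul_smul {r : unitInterval} {q : ℝ} (hq : 0 ≤ q) (h : q ≤ 1) (x : A) :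
    smul (clip (r * q)) x = smul r (smul (clip q) x) := by
  rw [smul_smul']
  congr 1
  ext
  rw [coe_clip (mul_nonneg r.2.1 hq) (mul_le_one₀ r.2.2 hq h), Set.Icc.coe_mul, coe_clip hq h]

variable {ι : Type*} [Fintype ι]

/-- The sum of the elements `a i` with small nonnegative weights. -/
noncomputable def comb (a : ι → A) (s : Finset ι) (w : ι → ℝ) : A :=
  ∑ i ∈ s, smul (clip (w i)) (a i)

theorem comb_add (a : ι → A) {w w' : ι → ℝ} (h0 : 0 ≤ w) (h0' : 0 ≤ w')
    (h : ∑ i, (w + w') i ≤ 1) :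
    comb a Finset.univ (w + w') = comb a Finset.univ w + comb a Finset.univ w' := by
  rw [comb, comb, comb, ← Finset.sum_add_distrib]
  refine Finset.sum_congr rfl fun i _ => clip_add_smul (h0 i) (h0' i) (le_trans ?_ h) (a i)
  exact Finset.single_le_sum (f := w + w') (fun j _ => add_nonneg (h0 j) (h0' j))
    (Finset.mem_univ i)

theorem comb_le (a : ι → A) {w : ι → ℝ} (h0 : 0 ≤ w) (s : Finset ι) (h : ∑ i ∈ s, w i ≤ 1) :
    comb a s w ≤ smul (clip (∑ i ∈ s, w i)) (neg 0) := by
  classical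
  induction s using Finset.induction_on with
  | empty => simp [comb]
  | insert i s hi ih =>
    rw [Finset.sum_insert hi] at h ⊢
    have hs : 0 ≤ ∑ j ∈ s, w j := Finset.sum_nonneg fun j _ => h0 j
    rw [comb, Finset.sum_insert hi, clip_add_smul (h0 i) hs h]
    exact add_le_add (smul_mono _ (le_neg_zero _)) (ih ((le_add_of_nonneg_left (h0 i)).trans h))

theorem comb_smul (a : ι → A) {w : ι → ℝ} (h0 : 0 ≤ w) (r : unitInterval) (s : Finset ι)
    (h : ∑ i ∈ s, w i ≤ 1) : comb a s ((r : ℝ) • w) = smul r (comb a s w) := by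
  classical
  induction s using Finset.induction_on with
  | empty => simp [comb, smul_zero']
  | insert i s hi ih =>
    rw [Finset.sum_insert hi] at h
    have hs : 0 ≤ ∑ j ∈ s, w j := Finset.sum_nonneg fun j _ => h0 j
    have hi0 := h0 i
    simp only [Pi.zero_apply] at hi0
    have hs1 : ∑ j ∈ s, w j ≤ 1 := by linarith
    have e := ih hs1
    simp only [comb] at e ⊢
    rw [Finset.sum_insert hi, Finset.sum_insert hi, e, smul_add_of_le_neg, Pi.smul_apply,
      smul_eq_mul, clip_mul_smul hi0 (by linarith)]
    refine le_neg_of_le_smul (p := clip (w i)) (q := clip (∑ j ∈ s, w j)) ?_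
      (smul_mono _ (le_neg_zero _)) (comb_le a h0 s hs1)
    rwa [coe_clip hi0 (by linarith), coe_clip hs hs1]

theorem comb_single [DecidableEq ι] (a : ι → A) (i : ι) (r : ℝ) :
    comb a Finset.univ (Pi.single i r) = smul (clip r) (a i) := by
  rw [comb, Finset.sum_eq_single i, Pi.single_eq_same]
  · intro j _ hj
    rw [Pi.single_eq_of_ne hj, clip_zero, zero_smul']
  · simp

/-- Weights that are nonnegative with sum at most `1/2`. -/
def IsSmall (w : ι → ℝ) : Prop := 0 ≤ w ∧ ∑ i, w i ≤ 1 / 2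

theorem IsSmall.le_one {w : ι → ℝ} (h : IsSmall w) : ∑ i, w i ≤ 1 := h.2.trans (by norm_num)

theorem IsSmall.convex {w w' : ι → ℝ} (h : IsSmall w) (h' : IsSmall w') {p q : ℝ} (hp : 0 ≤ p)
    (hq : 0 ≤ q) (hpq : p + q ≤ 1) : IsSmall (p • w + q • w') := by
  refine ⟨add_nonneg (smul_nonneg hp h.1) (smul_nonneg hq h'.1), ?_⟩
  simp only [Pi.add_apply, Pi.smul_apply, smul_eq_mul, Finset.sum_add_distrib, ← Finset.mul_sum]
  nlinarith [h.2, h'.2]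

theorem IsSmall.smul {w : ι → ℝ} (h : IsSmall w) (r : unitInterval) : IsSmall ((r : ℝ) • w) := by
  simpa using h.convex h r.2.1 le_rfl (by simpa using r.2.2)

theorem isSmall_zero : IsSmall (0 : ι → ℝ) := ⟨le_rfl, by simp⟩

theorem isSmall_single [DecidableEq ι] (i : ι) {r : ℝ} (h0 : 0 ≤ r) (h : r ≤ 1 / 2) :
    IsSmall (Pi.single i r : ι → ℝ) :=
  ⟨Pi.single_nonneg.2 h0, by rwa [Finset.sum_pi_single', if_pos (Finset.mem_univ i)]⟩

theorem IsSmall.comb_add (a : ι → A) {w w' : ι → ℝ} (h : IsSmall w) (h' : IsSmall w') :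
    comb a Finset.univ (w + w') = comb a Finset.univ w + comb a Finset.univ w' := by
  refine RieszMV.comb_add a h.1 h'.1 ?_
  simp only [Pi.add_apply, Finset.sum_add_distrib]
  linarith [h.2, h'.2]

theorem IsSmall.comb_le_neg (a : ι → A) {w w' : ι → ℝ} (h : IsSmall w) (h' : IsSmall w') :
    comb a Finset.univ w ≤ neg (comb a Finset.univ w') := by
  refine le_neg_of_le_smul ?_ (comb_le a h.1 _ h.le_one) (comb_le a h'.1 _ h'.le_one)
  rw [coe_clip (Finset.sum_nonneg fun i _ => h.1 i) h.le_one,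
    coe_clip (Finset.sum_nonneg fun i _ => h'.1 i) h'.le_one]
  linarith [h.2, h'.2]

/-- The cone of formal linear combinations of the `a i` that are nonnegative. -/
noncomputable def posCone (a : ι → A) : ConvexCone ℝ (ι → ℝ) where
  carrier := {c | ∃ (ε : ℝ) (w w' : ι → ℝ), 0 < ε ∧ ε ≤ 1 / 2 ∧ IsSmall w ∧ IsSmall w' ∧
    ε • c = w - w' ∧ comb a Finset.univ w' ≤ comb a Finset.univ w}
  smul_mem' := by
    rintro r hr c ⟨ε, w, w', hε, hε', hw, hw', hc, hle⟩
    have hr1 : 0 < 1 + r := by linarith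
    let p : unitInterval := ⟨r / (1 + r), by positivity, by rw [div_le_one hr1]; linarith⟩
    refine ⟨ε / (1 + r), (p : ℝ) • w, (p : ℝ) • w', by positivity, ?_, hw.smul p, hw'.smul p,
      ?_, ?_⟩
    · rw [div_le_iff₀ hr1]; nlinarith
    · rw [← _root_.smul_sub, ← hc, _root_.smul_smul, _root_.smul_smul]
      congr 1
      change ε / (1 + r) * r = r / (1 + r) * ε
      ring
    · rw [comb_smul a hw'.1 p _ hw'.le_one, comb_smul a hw.1 p _ hw.le_one]
      exact smul_mono p hle
  add_mem' := by
    rintro c ⟨ε, w, w', hε, hε', hw, hw', hc, hle⟩ d ⟨δ, z, z', hδ, hδ', hz, hz', hd, hle'⟩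
    have hs : 0 < ε + δ := by linarith
    let p : unitInterval := ⟨δ / (ε + δ), by positivity, by rw [div_le_one hs]; linarith⟩
    let q : unitInterval := ⟨ε / (ε + δ), by positivity, by rw [div_le_one hs]; linarith⟩
    have hpq : (p : ℝ) + q ≤ 1 := by
      change δ / (ε + δ) + ε / (ε + δ) ≤ 1
      rw [← add_div, add_comm, div_self hs.ne']
    refine ⟨ε * δ / (ε + δ), (p : ℝ) • w + (q : ℝ) • z, (p : ℝ) • w' + (q : ℝ) • z',
      by positivity, ?_, hw.convex hz p.2.1 q.2.1 hpq, hw'.convex hz' p.2.1 q.2.1 hpq, ?_, ?_⟩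
    · rw [div_le_iff₀ hs]; nlinarith
    · rw [add_sub_add_comm, ← _root_.smul_sub, ← _root_.smul_sub, ← hc, ← hd, _root_.smul_smul,
        _root_.smul_smul, smul_add]
      congr 2
      · change _ = δ / (ε + δ) * ε
        ring
      · change _ = ε / (ε + δ) * δ
        ring
    · rw [(hw.smul p).comb_add a (hz.smul q), (hw'.smul p).comb_add a (hz'.smul q),
        comb_smul a hw'.1 p _ hw'.le_one, comb_smul a hw.1 p _ hw.le_one,
        comb_smul a hz'.1 q _ hz'.le_one, comb_smul a hz.1 q _ hz.le_one]
      exact add_le_add (smul_mono p hle) (smul_mono q hle')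

theorem mem_posCone_of_smul_eq {a : ι → A} {c w w' : ι → ℝ} {ε : ℝ} (hε : 0 < ε) (hε' : ε ≤ 1 / 2)
    (hw : IsSmall w) (hw' : IsSmall w') (hc : ε • c = w - w')
    (h : comb a Finset.univ w' ≤ comb a Finset.univ w) : c ∈ posCone a :=
  ⟨ε, w, w', hε, hε', hw, hw', hc, h⟩

theorem single_sub_single_mem_posCone [DecidableEq ι] (a : ι → A) {i j : ι} :
    Pi.single i 1 - Pi.single j 1 ∈ posCone a ↔ a j ≤ a i := by
  constructor
  · rintro ⟨ε, w, w', hε, hε', hw, hw', hc, hle⟩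
    have hs : ∀ k : ι, IsSmall (Pi.single k ε : ι → ℝ) := fun k => isSmall_single k hε.le hε'
    have e : w' + Pi.single i ε = w + Pi.single j ε := by
      rw [_root_.smul_sub, ← Pi.single_smul, ← Pi.single_smul, smul_eq_mul, mul_one] at hc
      rw [add_comm, sub_eq_sub_iff_add_eq_add.1 hc]
    have e' := congrArg (comb a Finset.univ) e
    rw [hw'.comb_add a (hs i), hw.comb_add a (hs j)] at e'
    have h1 : comb a Finset.univ (Pi.single j ε) + comb a Finset.univ w'
        ≤ comb a Finset.univ (Pi.single i ε) + comb a Finset.univ w' := by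
      rw [add_comm _ (comb a Finset.univ w'), add_comm _ (comb a Finset.univ w'), e']
      gcongr
    have h2 := le_of_add_le_add ((hs j).comb_le_neg a hw') ((hs i).comb_le_neg a hw') h1
    rw [comb_single, comb_single] at h2
    refine le_of_smul_le_smul ?_ h2
    change (0 : ℝ) < clip ε
    rwa [coe_clip hε.le (by linarith)]
  · intro h
    refine mem_posCone_of_smul_eq (ε := 1 / 2) (by norm_num) le_rfl
      (isSmall_single i (r := 1 / 2) (by norm_num) le_rfl)
      (isSmall_single j (r := 1 / 2) (by norm_num) le_rfl) ?_ ?_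
    · rw [_root_.smul_sub, ← Pi.single_smul, ← Pi.single_smul, smul_eq_mul, mul_one]
    · rw [comb_single, comb_single]
      exact smul_mono _ h

end Comb

/-! ### Finite parts of totally ordered Riesz MV-algebras embed into `[0,1]` -/

section Chain

variable {A : Type*} [lang.Structure A] [Fact (IsRieszMVAlgebra A)]

theorem map_eq_of_comb_eq {ι : Type*} [Fintype ι] {a : ι → A} {φ : (ι → ℝ) →ₗ[ℝ] ℝ}
    (hφ : ∀ c ∈ posCone a, -c ∈ posCone a → φ c = 0) {w w' : ι → ℝ} (hw : IsSmall w)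
    (hw' : IsSmall w') (h : comb a Finset.univ w = comb a Finset.univ w') : φ w = φ w' := by
  have e : ∀ c : ι → ℝ, (1 / 2 : ℝ) • (2 : ℝ) • c = c := fun c => by
    rw [_root_.smul_smul]; norm_num
  have := hφ ((2 : ℝ) • (w - w'))
    (mem_posCone_of_smul_eq (by norm_num) le_rfl hw hw' (e _) h.ge)
    (mem_posCone_of_smul_eq (by norm_num) le_rfl hw' hw
      (by rw [← smul_neg, e, neg_sub]) h.le)
  rw [map_smul, map_sub, smul_eq_mul] at this
  linarith

/-- On a finite subset of a nontrivial Riesz MV-algebra there is a strictly increasing real valued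
function that respects the existing exact sums and scalar multiples. -/
theorem exists_strictMonoOn_real (hne : (0 : A) ≠ neg 0) {T : Set A} (hT : T.Finite)
    (h0 : (0 : A) ∈ T) (h1 : neg (0 : A) ∈ T) :
    ∃ g : A → ℝ, StrictMonoOn g T ∧ g 0 = 0 ∧ g (neg 0) = 1 ∧
      (∀ x ∈ T, ∀ y ∈ T, x + y ∈ T → x ≤ neg y → g (x + y) = g x + g y) ∧
      (∀ r : unitInterval, ∀ x ∈ T, smul r x ∈ T → g (smul r x) = r * g x) := by
  classical
  have := hT.fintype
  let a : T → A := Subtype.val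
  let e : A → T → ℝ := fun x i => if i.1 = x then 1 else 0
  have he : ∀ (x : A) (hx : x ∈ T), e x = Pi.single ⟨x, hx⟩ 1 := by
    intro x hx
    ext i
    simp only [e, Pi.single_apply, Subtype.ext_iff]
  let F : Set (T → ℝ) := {c | ∃ x ∈ T, ∃ y ∈ T, y < x ∧ c = e x - e y}
  have hF : F.Finite := (hT.image2 (fun x y => e x - e y) hT).subset (by
    rintro c ⟨x, hx, y, hy, -, rfl⟩
    exact ⟨x, hx, y, hy, rfl⟩)
  obtain ⟨φ, hφ, hφF⟩ := exists_linear_pos_of_finite (posCone a)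
    ⟨1 / 2, 0, 0, by norm_num, le_rfl, isSmall_zero, isSmall_zero, by simp, le_rfl⟩ hF (by
      rintro c ⟨x, hx, y, hy, hxy, rfl⟩
      rw [neg_sub, he x hx, he y hy, single_sub_single_mem_posCone, single_sub_single_mem_posCone]
      exact ⟨hxy.le, hxy.not_ge⟩)
  have hmono : ∀ x ∈ T, ∀ y ∈ T, x < y → φ (e x) < φ (e y) := fun x hx y hy hxy => by
    have := hφF _ ⟨y, hy, x, hx, hxy, rfl⟩
    rwa [map_sub, sub_pos] at this
  have hsingle : ∀ (x : A) (hx : x ∈ T) (r : ℝ), φ (Pi.single ⟨x, hx⟩ r) = r * φ (e x) := by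
    intro x hx r
    rw [he x hx, ← smul_eq_mul, ← map_smul, ← Pi.single_smul, smul_eq_mul, mul_one]
  have hadd : ∀ x ∈ T, ∀ y ∈ T, x + y ∈ T → x ≤ neg y → φ (e (x + y)) = φ (e x) + φ (e y) := by
    intro x hx y hy hxy h
    have hs : ∀ i : T, IsSmall (Pi.single i (1 / 4) : T → ℝ) := fun i =>
      isSmall_single i (by norm_num) (by norm_num)
    have hs' : IsSmall (Pi.single ⟨x, hx⟩ (1 / 4) + Pi.single ⟨y, hy⟩ (1 / 4) : T → ℝ) := by
      refine ⟨add_nonneg (hs _).1 (hs _).1, ?_⟩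
      simp only [Pi.add_apply, Finset.sum_add_distrib, Finset.sum_pi_single', Finset.mem_univ,
        if_true]
      norm_num
    have := map_eq_of_comb_eq hφ (hs ⟨_, hxy⟩) hs' (by
      rw [(hs _).comb_add a (hs _), comb_single, comb_single, comb_single]
      exact smul_add_of_le_neg _ h)
    rw [map_add, hsingle, hsingle, hsingle] at this
    linarith
  have hsmul : ∀ r : unitInterval, ∀ x ∈ T, smul r x ∈ T → φ (e (smul r x)) = r * φ (e x) := by
    intro r x hx hrx
    have hs : ∀ i : T, IsSmall (Pi.single i (1 / 2) : T → ℝ) := fun i =>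
      isSmall_single i (by norm_num) le_rfl
    have := map_eq_of_comb_eq hφ (hs ⟨_, hrx⟩) ((hs ⟨x, hx⟩).smul r) (by
      rw [comb_smul a (hs _).1 r _ (hs _).le_one, comb_single, comb_single, smul_smul', mul_comm,
        ← smul_smul'])
    rw [map_smul, hsingle, hsingle, smul_eq_mul] at this
    linarith
  have hz : φ (e 0) = 0 := by
    have := hadd 0 h0 0 h0 (by rwa [add_zero]) zero_le
    rw [add_zero] at this
    linarith
  have hpos : 0 < φ (e (neg 0)) := by
    rw [← hz]
    exact hmono _ h0 _ h1 (lt_of_le_of_ne zero_le hne)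
  refine ⟨fun x => φ (e x) / φ (e (neg 0)), fun x hx y hy hxy => ?_, ?_, div_self hpos.ne',
    fun x hx y hy hxy h => ?_, fun r x hx hrx => ?_⟩
  · exact div_lt_div_of_pos_right (hmono x hx y hy hxy) hpos
  · simp only [hz, zero_div]
  · simp only [hadd x hx y hy hxy h, add_div]
  · simp only [hsmul r x hx hrx, mul_div_assoc]

theorem exists_partial_embedding_of_neg_mem (htot : ∀ x y : A, x ≤ y ∨ y ≤ x)
    (hne : (0 : A) ≠ neg 0) {T : Set A} (hT : T.Finite) (h0 : (0 : A) ∈ T)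
    (hneg : ∀ x ∈ T, neg x ∈ T) :
    ∃ f : A → unitInterval, T.InjOn f ∧ ∀ (n : ℕ) (F : lang.Functions n) (v : Fin n → A),
      (∀ i, v i ∈ T) → FirstOrder.Language.Structure.funMap F v ∈ T →
      f (FirstOrder.Language.Structure.funMap F v) =
        FirstOrder.Language.Structure.funMap F (f ∘ v) := by
  have h1 := hneg 0 h0
  obtain ⟨g, hg, hg0, hg1, hadd, hsmul⟩ := exists_strictMonoOn_real hne hT h0 h1
  have hmem : ∀ x ∈ T, ((clip (g x) : unitInterval) : ℝ) = g x := fun x hx =>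
    coe_clip (hg0.symm.le.trans (hg.monotoneOn h0 hx zero_le))
      ((hg.monotoneOn hx h1 (le_neg_zero x)).trans hg1.le)
  have hgneg : ∀ x ∈ T, g (neg x) = 1 - g x := by
    intro x hx
    have := hadd _ (hneg x hx) x hx (by rwa [neg_add_self]) le_rfl
    rw [neg_add_self, hg1] at this
    linarith
  refine ⟨fun x => clip (g x), fun x hx y hy hxy => ?_, fun n F v hv hFv => ?_⟩
  · have hxy' : g x = g y := by rw [← hmem x hx, ← hmem y hy]; exact congrArg _ hxy
    rcases htot x y with h | h
    · by_contra hne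
      exact (hg hx hy (lt_of_le_of_ne h hne)).ne hxy'
    · by_contra hne
      exact (hg hy hx (lt_of_le_of_ne h (Ne.symm hne))).ne' hxy'
  · ext
    rw [hmem _ hFv]
    cases F with
    | zero =>
      rw [show FirstOrder.Language.Structure.funMap (L := lang) Func.zero v = (0 : A) from
        congrArg _ (Subsingleton.elim _ _), hg0]
      rfl
    | neg =>
      rw [show FirstOrder.Language.Structure.funMap (L := lang) Func.neg v = neg (v 0) from
        congrArg _ (funext fun i => by fin_cases i; rfl), hgneg _ (hv 0), ← hmem _ (hv 0)]
      rfl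
    | scal r =>
      have e : FirstOrder.Language.Structure.funMap (L := lang) (Func.scal r) v = smul r (v 0) :=
        congrArg _ (funext fun i => by fin_cases i; rfl)
      rw [e] at hFv ⊢
      rw [hsmul r _ (hv 0) hFv, ← hmem _ (hv 0)]
      rfl
    | oplus =>
      have e : FirstOrder.Language.Structure.funMap (L := lang) Func.oplus v = v 0 + v 1 :=
        congrArg _ (funext fun i => by fin_cases i <;> rfl)
      rw [e] at hFv ⊢
      change g (v 0 + v 1) = min 1 (((clip (g (v 0)) : unitInterval) : ℝ) +
        ((clip (g (v 1)) : unitInterval) : ℝ))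
      rw [hmem _ (hv 0), hmem _ (hv 1)]
      rcases htot (v 0) (neg (v 1)) with h | h
      · rw [← hadd _ (hv 0) _ (hv 1) hFv h, min_eq_right]
        exact (hg.monotoneOn hFv h1 (le_neg_zero _)).trans hg1.le
      · rw [add_eq_neg_zero h, hg1, min_eq_left]
        have := hg.monotoneOn (hneg _ (hv 1)) (hv 0) h
        rw [hgneg _ (hv 1)] at this
        linarith

/-- A finite subset of a nontrivial totally ordered Riesz MV-algebra embeds into `[0,1]` as a
partial algebra. -/
theorem exists_partial_embedding (htot : ∀ x y : A, x ≤ y ∨ y ≤ x) (hne : (0 : A) ≠ neg 0)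
    {T : Set A} (hT : T.Finite) :
    ∃ f : A → unitInterval, T.InjOn f ∧ ∀ (n : ℕ) (F : lang.Functions n) (v : Fin n → A),
      (∀ i, v i ∈ T) → FirstOrder.Language.Structure.funMap F v ∈ T →
      f (FirstOrder.Language.Structure.funMap F v) =
        FirstOrder.Language.Structure.funMap F (f ∘ v) := by
  have hT0 := hT.insert 0
  obtain ⟨f, hf, hf'⟩ := exists_partial_embedding_of_neg_mem htot hne
    (hT0.union (hT0.image neg)) (Or.inl (Set.mem_insert _ _)) (by
      rintro x (hx | ⟨y, hy, rfl⟩)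
      · exact Or.inr ⟨x, hx, rfl⟩
      · rw [neg_neg']
        exact Or.inl hy)
  have hsub : T ⊆ insert 0 T ∪ neg '' insert 0 T := fun x hx => Or.inl (Set.mem_insert_of_mem _ hx)
  exact ⟨f, hf.mono hsub, fun n F v hv hFv => hf' n F v (fun i => hsub (hv i)) (hsub hFv)⟩

end Chain

/-! ### Completeness -/

section Completeness

open FirstOrder.Language

variable {A : Type*} [lang.Structure A] {α : Type*}

/-- The set of the values of all subterms of a term. -/
def subtermValues (v : α → A) : lang.Term α → Set A
  | Term.var i => {v i}
  | Term.func F ts => insert ((Term.func F ts).realize v) (⋃ i, subtermValues v (ts i))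

theorem finite_subtermValues (v : α → A) (t : lang.Term α) : (subtermValues v t).Finite := by
  induction t with
  | var i => exact Set.finite_singleton _
  | func F ts ih => exact (Set.finite_iUnion ih).insert _

theorem realize_mem_subtermValues (v : α → A) (t : lang.Term α) :
    t.realize v ∈ subtermValues v t := by
  cases t with
  | var i => exact Set.mem_singleton _
  | func F ts => exact Set.mem_insert _ _

theorem apply_realize {B : Type*} [lang.Structure B] {T : Set A} {f : A → B}
    (hf : ∀ (n : ℕ) (F : lang.Functions n) (v : Fin n → A), (∀ i, v i ∈ T) →
      Structure.funMap F v ∈ T → f (Structure.funMap F v) = Structure.funMap F (f ∘ v))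
    (v : α → A) (t : lang.Term α) (ht : subtermValues v t ⊆ T) :
    f (t.realize v) = t.realize (f ∘ v) := by
  induction t with
  | var i => rfl
  | func F ts ih =>
    have hts : ∀ i, subtermValues v (ts i) ⊆ T := fun i =>
      (Set.subset_iUnion (fun j => subtermValues v (ts j)) i).trans
        ((Set.subset_insert _ _).trans ht)
    refine (hf _ F (fun i => (ts i).realize v)
      (fun i => hts i (realize_mem_subtermValues v (ts i)))
      (ht (realize_mem_subtermValues v (Term.func F ts)))).trans ?_
    exact congrArg _ (funext fun i => ih i (hts i))

/-- An equation that holds in `[0,1]` holds in every Riesz MV-algebra. -/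
theorem realize_eq_of_unitInterval {R : Type u} [lang.Structure R] (hR : IsRieszMVAlgebra R)
    {t s : lang.Term α} (h : ∀ v : α → unitInterval, t.realize v = s.realize v) (v : α → R) :
    t.realize v = s.realize v := by
  by_contra hne
  obtain ⟨B, _, p, hB, htot, hp⟩ := exists_chain_quotient hR hne
  have : Fact (IsRieszMVAlgebra B) := ⟨hB⟩
  rw [← HomClass.realize_term, ← HomClass.realize_term] at hp
  have hne' : (0 : B) ≠ neg 0 := by
    intro h0
    have hall : ∀ x : B, x = 0 := fun x => nonpos_iff_eq_zero.1 ((le_neg_zero x).trans h0.ge)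
    exact hp ((hall _).trans (hall _).symm)
  obtain ⟨f, hf, hf'⟩ := exists_partial_embedding (A := B) htot hne'
    ((finite_subtermValues (p ∘ v) t).union (finite_subtermValues (p ∘ v) s))
  refine hp (hf (Or.inl (realize_mem_subtermValues _ _)) (Or.inr (realize_mem_subtermValues _ _)) ?_)
  rw [apply_realize hf' _ t Set.subset_union_left, apply_realize hf' _ s Set.subset_union_right, h]

end Completeness

/-! ### The generated variety -/

section Variety

open FirstOrder.Language CategoryTheory

/-- The standard algebra in an arbitrary universe. -/
instance uliftStructure : lang.Structure (ULift.{u} unitInterval) where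
  funMap F v := ULift.up (Structure.funMap F fun i => (v i).down)
  RelMap r := r.elim

/-- The standard algebra is isomorphic to its copy in an arbitrary universe. -/
def uliftEquiv : ULift.{u} unitInterval ≃[lang] unitInterval where
  toEquiv := Equiv.ulift
  map_fun' _ _ := rfl
  map_rel' r := r.elim

theorem IsRieszMVAlgebra.of_equiv {A B : Type*} [lang.Structure A] [lang.Structure B]
    (h : IsRieszMVAlgebra A) (e : B ≃[lang] A) : IsRieszMVAlgebra B :=
  .of_separating (ι := Unit) (fun _ => h) (fun _ => e.toHom) fun _ _ hxy => e.injective (hxy ())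

/-- A projection of a direct product. -/
def piEval {ι : Type*} (A : ι → Type*) [∀ i, lang.Structure (A i)] (i : ι) :
    (∀ i, A i) →[lang] A i where
  toFun x := x i
  map_fun' _ _ := rfl
  map_rel' r := r.elim

theorem isVariety_rieszMVAlgebras : IsVariety rieszMVAlgebras.{u} where
  image _ _ f hf hA := IsRieszMVAlgebra.of_surjective hA f hf
  sub _ S hA := IsRieszMVAlgebra.of_separating (ι := Unit) (fun _ => hA)
    (fun _ => S.subtype.toHom) fun _ _ hxy => S.subtype.injective (hxy ())
  prod _ A hA := IsRieszMVAlgebra.of_separating hA (fun i => piEval (fun i => A i) i)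
    fun _ _ hxy => funext hxy

theorem realize_pi {ι α : Type*} (A : ι → Type*) [∀ i, lang.Structure (A i)]
    (v : α → ∀ i, A i) (t : lang.Term α) (i : ι) :
    t.realize v i = t.realize fun a => v a i :=
  (HomClass.realize_term (piEval A i)).symm

/-- Every Riesz MV-algebra is a homomorphic image of a subalgebra of a power of `[0,1]`. -/
theorem mem_generatedVariety_of_isRieszMVAlgebra (R : Bundled.{u} lang.Structure)
    (hR : IsRieszMVAlgebra R) : R ∈ generatedVariety.{u} unitInterval := by
  rintro K ⟨hK, hstd⟩
  have hU : Bundled.of (c := lang.Structure) (ULift.{u} unitInterval) ∈ K := hstd _ ⟨uliftEquiv⟩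
  let P := (R → unitInterval) → ULift.{u} unitInterval
  have hP : Bundled.of (c := lang.Structure) P ∈ K :=
    hK.prod (R → unitInterval) (fun _ => Bundled.of (c := lang.Structure) (ULift.{u} unitInterval))
      fun _ => hU
  let proj : R → P := fun x v => ULift.up (v x)
  let S : lang.Substructure P :=
    { carrier := Set.range fun t : lang.Term R => t.realize proj
      fun_mem := fun {n} F xs hxs => by
        choose ts hts using hxs
        exact ⟨Term.func F ts, congrArg _ (funext hts)⟩ }
  have hS := hK.sub _ S hP
  have heq : ∀ t s : lang.Term R, t.realize proj = s.realize proj →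
      t.realize (id : R → R) = s.realize id := by
    intro t s hts
    refine realize_eq_of_unitInterval hR (fun v => ?_) _
    have h := congrArg ULift.down (congrFun hts v)
    rw [realize_pi, realize_pi] at h
    change uliftEquiv.{u} _ = uliftEquiv.{u} _ at h
    rwa [← HomClass.realize_term uliftEquiv, ← HomClass.realize_term uliftEquiv] at h
  let term : S → lang.Term R := fun p => p.2.choose
  have hterm : ∀ p : S, (term p).realize proj = p := fun p => p.2.choose_spec
  let f : S →[lang] R :=
    { toFun := fun p => (term p).realize id
      map_fun' := fun {n} F ps => heq _ (Term.func F fun i => term (ps i)) (by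
        rw [hterm]
        exact congrArg (Structure.funMap F) (funext fun i => (hterm (ps i)).symm))
      map_rel' := fun r => r.elim }
  refine hK.image (Bundled.of (c := lang.Structure) S) R f (fun x => ?_) hS
  exact ⟨⟨proj x, Term.var x, rfl⟩, heq _ (Term.var x) (hterm _)⟩

end Variety

end RieszMV

/-- An equation holds in all Riesz MV-algebras iff it holds in the standard Riesz MV-algebra
`[0,1]`; and the class of Riesz MV-algebras is the variety generated by `[0,1]`. -/
theorem theorem4p4 :
    (∀ t s : RieszMV.lang.Term ℕ,
      (∀ (R : Type u) [RieszMV.lang.Structure R],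
          RieszMV.IsRieszMVAlgebra R → RieszMV.HoldsIn R t s) ↔
        RieszMV.HoldsIn unitInterval t s) ∧
    RieszMV.rieszMVAlgebras.{u} = RieszMV.generatedVariety.{u} unitInterval := by
  refine ⟨fun t s => ⟨fun h v => ?_, fun h R _ hR v => RieszMV.realize_eq_of_unitInterval hR h v⟩,
    Set.Subset.antisymm (fun R hR => RieszMV.mem_generatedVariety_of_isRieszMVAlgebra R hR)
      (Set.sInter_subset_of_mem ⟨RieszMV.isVariety_rieszMVAlgebras, ?_⟩)⟩
  · have e := RieszMV.uliftEquiv.{u}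
    have := congrArg e (h (ULift.{u} unitInterval)
      (RieszMV.isRieszMVAlgebra_unitInterval.of_equiv e) (fun i => e.symm (v i)))
    rw [← FirstOrder.Language.HomClass.realize_term, ← FirstOrder.Language.HomClass.realize_term]
      at this
    simpa [Function.comp_def] using this
  · rintro B ⟨e⟩
    exact RieszMV.isRieszMVAlgebra_unitInterval.of_equiv e
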